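/- For a commutative ring $A$ and positive integers $i,j,m,n$ let $R(A;i,j,m,n)=A\langle x,y : x^iy^m+y^nx^j=1,\ y^{m+n}=0\rangle$ be the quotient of the free associative unital $A$-algebra on $x,y$ by the two-sided ideal generated by $x^iy^m+y^nx^j-1$ and $y^{m+n}$. Let $\mathcal{A}_A$ be the set of quadruples $(i,j,m,n)$ of positive integers for which there is a non-trivial (that is, not identically zero) unital $A$-algebra homomorphism $R(A;i,j,m,n)\to M_{m+n}(A)$ to the ring of $(m+n)\times(m+n)$ matrices over $A$. **Theorem.** Let $i,j$ be positive integers. Then $(i,j,1,1)\in\mathcal{A}_{\mathbb{Q}}$ (that is, there are $2\times 2$ rational matrices $x,y$ with $x^iy+yx^j=1$ and $y^2=0$) if and only if at least one of the following holds: - $i=j$ and $i\not\equiv 0\pmod 4$; - $(i,j)\equiv(1,1)\pmod 2$, i.e. $i$ and $j$ are both odd; - $(i,j)\equiv(1,2),\ (2,1),\ (4,5)$ or $(5,4)\pmod 6$. -/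

import Mathlib

namespace MatrixRelations

/-- The defining relations `x ^ i * y ^ m + y ^ n * x ^ j = 1` and `y ^ (m + n) = 0` on the free
`A`-algebra on two indeterminates `x = ι 0` and `y = ι 1`. -/
inductive Rel (A : Type*) [CommRing A] (i j m n : ℕ) :
    FreeAlgebra A (Fin 2) → FreeAlgebra A (Fin 2) → Prop
  | unit : Rel A i j m n
      (FreeAlgebra.ι A 0 ^ i * FreeAlgebra.ι A 1 ^ m
        + FreeAlgebra.ι A 1 ^ n * FreeAlgebra.ι A 0 ^ j) 1
  | nilp : Rel A i j m n (FreeAlgebra.ι A 1 ^ (m + n)) 0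

/-- The `A`-algebra `R(A; i, j, m, n) = A⟨x, y : x ^ i y ^ m + y ^ n x ^ j = 1, y ^ (m + n) = 0⟩`,
the quotient of the free `A`-algebra on `x, y` by the two-sided ideal of the relations. -/
abbrev R (A : Type*) [CommRing A] (i j m n : ℕ) : Type _ :=
  RingQuot (Rel A i j m n)

/-- The set `𝒜_A` of quadruples `(i, j, m, n)` of positive integers for which there is a nonzero
(unital) homomorphism of `A`-algebras from `R(A; i, j, m, n)` to the ring of
`(m + n) × (m + n)` matrices over `A`. -/
def setA (A : Type*) [CommRing A] : Set (ℕ × ℕ × ℕ × ℕ) :=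
  {q | match q with
    | (i, j, m, n) => (0 < i ∧ 0 < j ∧ 0 < m ∧ 0 < n) ∧
        ∃ φ : R A i j m n →ₐ[A] Matrix (Fin (m + n)) (Fin (m + n)) A, ∃ r, φ r ≠ 0}

end MatrixRelations

namespace MatrixRelations

open Matrix

/-! Conjugating `y` to the standard nilpotent matrix leaves three conditions on entries of `x ^ i`
and `x ^ j`. If `x` has distinct complex eigenvalues `α`, `β`, they give `α ^ j = -β ^ i`, `α ^ i =
-β ^ j` and `α ^ i ≠ β ^ i` (`eigenvalue_relations`); a double eigenvalue leaves only `i = j = 1`.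
Rationality of trace and determinant does the rest, since a rational `z + z⁻¹` with `z` a root of
unity is one of `0, ±1, ±2`. For `i = j` this applies to `z = α / β`, where `z ^ i = -1`. For `i ≠
j`, `α` and `β` are themselves roots of unity, and either `β = -α` (both exponents odd) or `α`, `β`
are the primitive sixth roots of unity; primitive cube roots are excluded because `α ^ (i + j) =
-1`. Explicit matrices with such eigenvalues give the converse. -/

/-- Membership of `(i, j, 1, 1)` in `setA A`, in terms of pairs of matrices. -/
lemma mem_setA_one_one_iff {A : Type*} [CommRing A] [Nontrivial A] {i j : ℕ}
    (hi : 0 < i) (hj : 0 < j) :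
    (i, j, 1, 1) ∈ setA A ↔
      ∃ x y : Matrix (Fin 2) (Fin 2) A, x ^ i * y + y * x ^ j = 1 ∧ y ^ 2 = 0 := by
  constructor
  · rintro ⟨-, φ, -⟩
    refine ⟨φ (RingQuot.mkAlgHom A _ (FreeAlgebra.ι A 0)),
      φ (RingQuot.mkAlgHom A _ (FreeAlgebra.ι A 1)), ?_, ?_⟩
    · have h := congrArg φ (RingQuot.mkAlgHom_rel A (Rel.unit (A := A) (i := i) (j := j)
        (m := 1) (n := 1)))
      simpa only [map_add, map_mul, map_pow, map_one, pow_one] using h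
    · have h := congrArg φ (RingQuot.mkAlgHom_rel A (Rel.nilp (A := A) (i := i) (j := j)
        (m := 1) (n := 1)))
      simpa only [map_pow, map_zero] using h
  · rintro ⟨x, y, h1, h2⟩
    refine ⟨⟨hi, hj, one_pos, one_pos⟩,
      RingQuot.liftAlgHom A ⟨FreeAlgebra.lift A (![x, y] : Fin 2 → Matrix (Fin 2) (Fin 2) A), ?_⟩,
      1, ?_⟩
    · intro a b h
      cases h with
      | unit => simpa using h1
      | nilp => simpa using h2
    · rw [map_one]
      exact one_ne_zero

/-- A nonzero `2 × 2` matrix of square zero is conjugate to the standard nilpotent one. -/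
lemma exists_conj_of_sq_eq_zero {K : Type*} [Field K] {y : Matrix (Fin 2) (Fin 2) K}
    (hy : y ^ 2 = 0) (hy0 : y ≠ 0) :
    ∃ P : Matrix (Fin 2) (Fin 2) K, IsUnit P.det ∧ y * P = P * !![0, 1; 0, 0] := by
  obtain ⟨p, hp⟩ : ∃ p : Fin 2 → K, y *ᵥ p ≠ 0 := by
    by_contra! h
    exact hy0 (Matrix.ext_of_mulVec_single fun k => by rw [h, zero_mulVec])
  have hyy : y *ᵥ (y *ᵥ p) = 0 := by rw [mulVec_mulVec, ← sq, hy, zero_mulVec]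
  set q := y *ᵥ p with hq
  -- The basis is `y p, p`; a linear dependence, hit with `y`, would force `y p = 0`.
  refine ⟨!![q 0, p 0; q 1, p 1], ?_, ?_⟩
  · rw [isUnit_iff_ne_zero, det_fin_two_of]
    intro hdet
    have h0 : q 0 • p = p 0 • q := by
      ext k; fin_cases k
      · exact mul_comm _ _
      · simp; linear_combination hdet
    have h1 : q 1 • p = p 1 • q := by
      ext k; fin_cases k
      · simp; linear_combination -hdet
      · exact mul_comm _ _
    have e0 := congrArg (y *ᵥ ·) h0
    have e1 := congrArg (y *ᵥ ·) h1
    simp only [mulVec_smul, hyy, ← hq, smul_zero] at e0 e1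
    apply hp
    ext k; fin_cases k
    · exact (smul_eq_zero.1 e0).resolve_right hp
    · exact (smul_eq_zero.1 e1).resolve_right hp
  · have a0 := congrFun hyy 0
    have a1 := congrFun hyy 1
    have b0 := congrFun hq 0
    have b1 := congrFun hq 1
    simp only [mulVec, dotProduct, Fin.sum_univ_two, Pi.zero_apply] at a0 a1 b0 b1
    ext k l
    fin_cases k <;> fin_cases l <;>
      simp [Matrix.mul_apply, Fin.sum_univ_two, a0, a1, ← b0, ← b1]

/-- The nilpotent matrix may be taken to be the standard one; the relation then becomes three
conditions on entries. -/
lemma exists_entries_of_rel {K : Type*} [Field K] {i j : ℕ} {x y : Matrix (Fin 2) (Fin 2) K}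
    (h : x ^ i * y + y * x ^ j = 1) (hy : y ^ 2 = 0) :
    ∃ z : Matrix (Fin 2) (Fin 2) K,
      (z ^ i) 1 0 = 1 ∧ (z ^ j) 1 0 = 1 ∧ (z ^ i) 0 0 + (z ^ j) 1 1 = 0 := by
  have hy0 : y ≠ 0 := by
    rintro rfl
    simp at h
  obtain ⟨P, hP, hyP⟩ := exists_conj_of_sq_eq_zero hy hy0
  have hPP : P * P⁻¹ = 1 := mul_nonsing_inv P hP
  have hPP' : P⁻¹ * P = 1 := nonsing_inv_mul P hP
  have hpow : ∀ n : ℕ, (P⁻¹ * x * P) ^ n = P⁻¹ * x ^ n * P := by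
    intro n
    induction n with
    | zero => simp [hPP']
    | succ n ih =>
      rw [pow_succ, ih, pow_succ]
      calc P⁻¹ * x ^ n * P * (P⁻¹ * x * P) = P⁻¹ * x ^ n * (P * P⁻¹) * x * P := by noncomm_ring
        _ = P⁻¹ * (x ^ n * x) * P := by rw [hPP]; noncomm_ring
  have key : (P⁻¹ * x * P) ^ i * !![0, 1; 0, 0] + !![0, 1; 0, 0] * (P⁻¹ * x * P) ^ j = 1 := by
    have hE : (!![0, 1; 0, 0] : Matrix (Fin 2) (Fin 2) K) = P⁻¹ * y * P := by
      rw [Matrix.mul_assoc, hyP, ← Matrix.mul_assoc, hPP', Matrix.one_mul]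
    rw [hE, hpow, hpow]
    calc P⁻¹ * x ^ i * P * (P⁻¹ * y * P) + P⁻¹ * y * P * (P⁻¹ * x ^ j * P)
        = P⁻¹ * (x ^ i * (P * P⁻¹) * y + y * (P * P⁻¹) * x ^ j) * P := by noncomm_ring
      _ = 1 := by rw [hPP, Matrix.mul_one, Matrix.mul_one, h, Matrix.mul_one, hPP']
  refine ⟨P⁻¹ * x * P, ?_⟩
  generalize P⁻¹ * x * P = z at key
  have k00 := congrFun (congrFun key 0) 0
  have k01 := congrFun (congrFun key 0) 1
  have k11 := congrFun (congrFun key 1) 1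
  simp only [Matrix.add_apply, Matrix.mul_apply, Fin.sum_univ_two] at k00 k01 k11
  simp at k00 k01 k11
  exact ⟨k11, k00, k01⟩

/-- Conversely, the conditions on entries give a pair satisfying the relations. -/
lemma exists_rel_of_entries {A : Type*} [CommRing A] {i j : ℕ} (x : Matrix (Fin 2) (Fin 2) A)
    (h1 : (x ^ i) 1 0 = 1) (h2 : (x ^ j) 1 0 = 1) (h3 : (x ^ i) 0 0 + (x ^ j) 1 1 = 0) :
    ∃ x y : Matrix (Fin 2) (Fin 2) A, x ^ i * y + y * x ^ j = 1 ∧ y ^ 2 = 0 := by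
  refine ⟨x, !![0, 1; 0, 0], ?_, ?_⟩
  · ext k l
    fin_cases k <;> fin_cases l <;>
      simp only [Matrix.add_apply, Matrix.mul_apply, Fin.sum_univ_two] <;> simp [h1, h2, h3]
  · ext k l
    fin_cases k <;> fin_cases l <;> simp [sq]

/-! ### Powers of a 2 × 2 matrix through its eigenvalues -/

section Powers

variable {K : Type*} [CommRing K] {x : Matrix (Fin 2) (Fin 2) K} {α β : K}

lemma mul_self_fin_two (hs : α + β = x 0 0 + x 1 1) (hp : α * β = x 0 0 * x 1 1 - x 0 1 * x 1 0) :
    x * x = (α + β) • x - (α * β) • (1 : Matrix (Fin 2) (Fin 2) K) := by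
  rw [hs, hp]
  ext k l
  fin_cases k <;> fin_cases l <;> simp [Matrix.mul_apply, Fin.sum_univ_two] <;> ring

/-- Spectral decomposition by Cayley–Hamilton, multiplied by `α - β` to avoid division. -/
lemma sub_smul_pow_fin_two (hs : α + β = x 0 0 + x 1 1)
    (hp : α * β = x 0 0 * x 1 1 - x 0 1 * x 1 0) (n : ℕ) :
    (α - β) • x ^ n = α ^ n • (x - β • 1) - β ^ n • (x - α • 1) := by
  induction n with
  | zero => simp; module
  | succ n ih =>
    rw [pow_succ x, ← smul_mul_assoc, ih]
    simp only [Matrix.sub_mul, smul_mul_assoc, Matrix.one_mul, mul_self_fin_two hs hp]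
    module

lemma pow_succ_fin_two_of_eq (hs : α + α = x 0 0 + x 1 1)
    (hp : α * α = x 0 0 * x 1 1 - x 0 1 * x 1 0) (n : ℕ) :
    x ^ (n + 1) = ((n + 1) * α ^ n) • x - (n * α ^ (n + 1)) • 1 := by
  induction n with
  | zero => simp
  | succ n ih =>
    rw [pow_succ x, ih]
    simp only [Matrix.sub_mul, smul_mul_assoc, Matrix.one_mul, mul_self_fin_two hs hp]
    push_cast
    module

end Powers

/-- The relations on the eigenvalues, when they are distinct. -/
lemma eigenvalue_relations {K : Type*} [Field K] {i j : ℕ} {x : Matrix (Fin 2) (Fin 2) K} {α β : K}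
    (hs : α + β = x 0 0 + x 1 1) (hp : α * β = x 0 0 * x 1 1 - x 0 1 * x 1 0) (hne : α ≠ β)
    (h1 : (x ^ i) 1 0 = 1) (h2 : (x ^ j) 1 0 = 1) (h3 : (x ^ i) 0 0 + (x ^ j) 1 1 = 0) :
    α ^ j = -β ^ i ∧ α ^ i = -β ^ j ∧ α ^ i ≠ β ^ i ∧ α ^ j ≠ β ^ j := by
  have hsub : α - β ≠ 0 := sub_ne_zero.2 hne
  have e1 := congrFun (congrFun (sub_smul_pow_fin_two hs hp i) 1) 0
  have e2 := congrFun (congrFun (sub_smul_pow_fin_two hs hp j) 1) 0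
  have e3 := congrFun (congrFun (sub_smul_pow_fin_two hs hp i) 0) 0
  have e4 := congrFun (congrFun (sub_smul_pow_fin_two hs hp j) 1) 1
  simp [h1, h2] at e1 e2 e3 e4
  have hc : x 1 0 ≠ 0 := by
    intro h
    rw [h] at e1
    exact hsub (by linear_combination e1)
  have hA : α ^ i - β ^ i = α ^ j - β ^ j :=
    mul_right_cancel₀ hc (by linear_combination e2 - e1)
  have hB : α ^ j = -β ^ i := by
    apply mul_left_cancel₀ hsub
    linear_combination (α - β) * h3 - e3 - e4 - (x 0 0 - β) * hA + (α ^ j - β ^ j) * hs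
  refine ⟨hB, by linear_combination hA + hB, ?_, ?_⟩
  · intro h
    rw [h] at e1
    exact hsub (by linear_combination e1)
  · intro h
    rw [h] at e2
    exact hsub (by linear_combination e2)

/-- A repeated eigenvalue forces `i = j = 1`. -/
lemma eq_one_of_double_eigenvalue {K : Type*} [Field K] [CharZero K] {i j : ℕ}
    {x : Matrix (Fin 2) (Fin 2) K} {α : K} (hi : 0 < i) (hj : 0 < j)
    (hs : α + α = x 0 0 + x 1 1) (hp : α * α = x 0 0 * x 1 1 - x 0 1 * x 1 0)
    (h1 : (x ^ i) 1 0 = 1) (h2 : (x ^ j) 1 0 = 1) (h3 : (x ^ i) 0 0 + (x ^ j) 1 1 = 0) :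
    i = 1 ∧ j = 1 := by
  obtain ⟨i, rfl⟩ := Nat.exists_eq_add_of_lt hi
  obtain ⟨j, rfl⟩ := Nat.exists_eq_add_of_lt hj
  simp only [zero_add] at *
  rw [pow_succ_fin_two_of_eq hs hp] at h1 h2 h3
  rw [pow_succ_fin_two_of_eq hs hp] at h3
  simp at h1 h2 h3
  have hc : x 1 0 ≠ 0 := by
    intro h
    simp [h] at h1
  have hA : ((i : K) + 1) * α ^ i = (j + 1) * α ^ j :=
    mul_right_cancel₀ hc (by rw [h1, h2])
  have hB : α ^ (i + 1) + α ^ (j + 1) = 0 := by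
    simp only [pow_succ] at h3 ⊢
    linear_combination h3 + (α - x 0 0) * hA + (j + 1) * α ^ j * hs
  -- By `hA` and `hB`, `(i + 1) α ^ (i + 1) = (j + 1) α ^ (j + 1) = -(j + 1) α ^ (i + 1)`. So `α =
  -- 0`, and a shifted exponent above `0` would kill the lower-left entry.
  have hC : ((i : K) + 1 + (j + 1)) * α ^ (i + 1) = 0 := by
    simp only [pow_succ] at hB ⊢
    linear_combination α * hA + (j + 1) * hB
  have hij : ((i : K) + 1 + (j + 1)) ≠ 0 := by
    exact_mod_cast (by omega : i + 1 + (j + 1) ≠ 0)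
  have hα : α = 0 := pow_eq_zero_iff (Nat.succ_ne_zero i) |>.1 ((mul_eq_zero.1 hC).resolve_left hij)
  subst hα
  constructor
  · by_contra h
    rw [zero_pow (by omega)] at h1
    simp at h1
  · by_contra h
    rw [zero_pow (by omega)] at h2
    simp at h2

/-! ### Roots of unity with rational trace -/

/-- A rational of the form `z + z⁻¹` with `z` a root of unity is an integer of absolute value at
most two. -/
lemma rat_eq_of_add_inv {z : ℂ} {n : ℕ} (hn : 0 < n) (hz : z ^ n = 1) {t : ℚ}
    (ht : z + z⁻¹ = t) : t = -2 ∨ t = -1 ∨ t = 0 ∨ t = 1 ∨ t = 2 := by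
  have h1 : IsIntegral ℤ z := IsIntegral.of_pow hn (hz ▸ isIntegral_one)
  have h2 : IsIntegral ℤ z⁻¹ :=
    IsIntegral.of_pow hn (by rw [inv_pow, hz, inv_one]; exact isIntegral_one)
  have h3 : IsIntegral ℤ (algebraMap ℚ ℂ t) := by
    rw [eq_ratCast, ← ht]
    exact h1.add h2
  rw [isIntegral_algebraMap_iff (algebraMap ℚ ℂ).injective, IsIntegrallyClosed.isIntegral_iff] at h3
  obtain ⟨k, hk⟩ := h3
  rw [eq_intCast] at hk
  subst hk
  have hnorm : ‖z‖ = 1 := Complex.norm_eq_one_of_pow_eq_one hz hn.ne'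
  have hle : ‖z + z⁻¹‖ ≤ 2 := (norm_add_le _ _).trans (by rw [norm_inv, hnorm]; norm_num)
  rw [ht] at hle
  have hle' : |(k : ℝ)| ≤ 2 := by simpa using hle
  have hk2 : |k| ≤ 2 := by exact_mod_cast hle'
  obtain ⟨ha, hb⟩ := abs_le.1 hk2
  interval_cases k <;> simp

/-- A nonzero element with two equal powers is a root of unity. -/
lemma exists_pow_eq_one_of_pow_eq_pow {K : Type*} [Field K] {a : K} (ha : a ≠ 0) {m n : ℕ}
    (hmn : m ≠ n) (h : a ^ m = a ^ n) : ∃ k, 0 < k ∧ a ^ k = 1 := by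
  wlog hlt : m < n generalizing m n
  · exact this hmn.symm h.symm (by omega)
  obtain ⟨k, rfl⟩ := Nat.exists_eq_add_of_lt hlt
  refine ⟨k + 1, k.succ_pos, mul_left_cancel₀ (pow_ne_zero m ha) ?_⟩
  rw [← pow_add, mul_one, h, add_assoc]

lemma exists_pow_eq_one_of_relations {K : Type*} [Field K] {i j : ℕ} (hij : i ≠ j) {α β : K}
    (hα : α ≠ 0) (h1 : α ^ j = -β ^ i) (h2 : α ^ i = -β ^ j) : ∃ k, 0 < k ∧ α ^ k = 1 := by
  -- Both powers equal `β ^ (2 * i * j)`; the factor 2 removes the signs.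
  refine exists_pow_eq_one_of_pow_eq_pow hα (m := j * (2 * j)) (n := i * (2 * i)) ?_ ?_
  · intro h
    exact hij (Nat.mul_self_inj.1 (by linarith))
  · rw [pow_mul α j, pow_mul α i, h1, h2, (even_two_mul j).neg_pow, (even_two_mul i).neg_pow,
      ← pow_mul, ← pow_mul]
    congr 1
    ring

/-- The ratio `z = α / β` has `z + z⁻¹ = T ^ 2 / D - 2` rational, so `z ^ 12 = 1`. If `4 ∣ i`, then
`(z ^ i) ^ 3 = 1`, against `z ^ i = -1`. -/
lemma not_four_dvd_of_relations {i : ℕ} {α β : ℂ} {T D : ℚ} (hi : 0 < i)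
    (hT : α + β = T) (hD : α * β = D) (hα : α ≠ 0) (hβ : β ≠ 0) (h : α ^ i = -β ^ i) :
    ¬ 4 ∣ i := by
  rintro ⟨k, rfl⟩
  have hz : (α / β) ^ (4 * k) = -1 := by
    rw [div_pow, h, neg_div, div_self (pow_ne_zero _ hβ)]
  have hz0 : α / β ≠ 0 := div_ne_zero hα hβ
  have ht : α / β + (α / β)⁻¹ = ((T ^ 2 / D - 2 : ℚ) : ℂ) := by
    push_cast
    rw [← hT, ← hD]
    field_simp
    ring
  have hcases := rat_eq_of_add_inv (n := 4 * k * 2) (by omega) (by rw [pow_mul, hz]; norm_num) ht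
  generalize T ^ 2 / D - 2 = t at ht hcases
  generalize α / β = z at hz hz0 ht
  have hq : z ^ 2 = t * z - 1 := by
    field_simp at ht
    linear_combination ht
  have h12 : z ^ 12 = 1 := by
    rcases hcases with rfl | rfl | rfl | rfl | rfl
    · have : z = -1 := by
        have : (z + 1) ^ 2 = 0 := by push_cast at hq; linear_combination hq
        linear_combination pow_eq_zero_iff two_ne_zero |>.1 this
      rw [this]; norm_num
    · have : z ^ 3 = 1 := by push_cast at hq; linear_combination (z - 1) * hq
      rw [show 12 = 3 * 4 from rfl, pow_mul, this, one_pow]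
    · have : z ^ 2 = -1 := by push_cast at hq; linear_combination hq
      rw [show 12 = 2 * 6 from rfl, pow_mul, this]; norm_num
    · have : z ^ 3 = -1 := by push_cast at hq; linear_combination (z + 1) * hq
      rw [show 12 = 3 * 4 from rfl, pow_mul, this]; norm_num
    · have : z = 1 := by
        have : (z - 1) ^ 2 = 0 := by push_cast at hq; linear_combination hq
        linear_combination pow_eq_zero_iff two_ne_zero |>.1 this
      rw [this]; norm_num
  have h3 : (z ^ (4 * k)) ^ 3 = 1 := by
    rw [← pow_mul, show 4 * k * 3 = 12 * k by ring, pow_mul, h12, one_pow]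
  rw [hz] at h3
  norm_num at h3

/-- The trace and determinant of a solution with distinct eigenvalues, for `i ≠ j`. -/
lemma trace_det_of_relations {i j : ℕ} (hij : i ≠ j) {α β : ℂ} {T D : ℚ}
    (hT : α + β = T) (hD : α * β = D) (hα : α ≠ 0) (hβ : β ≠ 0) (hne : α ≠ β)
    (h1 : α ^ j = -β ^ i) (h2 : α ^ i = -β ^ j) : T = 0 ∨ D = 1 ∧ (T = 1 ∨ T = -1) := by
  obtain ⟨k, hk, hαk⟩ := exists_pow_eq_one_of_relations hij hα h1 h2
  obtain ⟨l, hl, hβl⟩ := exists_pow_eq_one_of_relations hij hβ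
    (show β ^ j = -α ^ i by rw [h2, neg_neg]) (show β ^ i = -α ^ j by rw [h1, neg_neg])
  have hDkl : D ^ (k * l) = 1 := by
    have : (α * β) ^ (k * l) = 1 := by
      rw [mul_pow, pow_mul, hαk, mul_comm k l, pow_mul, hβl, one_pow, one_pow, one_mul]
    rw [hD] at this
    exact_mod_cast this
  have hDabs : |D| = 1 :=
    (pow_eq_one_iff_of_nonneg (abs_nonneg D) (Nat.mul_pos hk hl).ne').1
      (by rw [← abs_pow, hDkl, abs_one])
  rcases eq_or_eq_neg_of_abs_eq hDabs with rfl | rfl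
  · have hβα : β = α⁻¹ := eq_inv_of_mul_eq_one_right (by simpa using hD)
    -- The discriminant rules out `T = ±2`.
    have hsq : (α - β) ^ 2 = T ^ 2 - 4 := by
      push_cast at hD
      linear_combination (α + β + T) * hT - 4 * hD
    have hsq0 : (α - β) ^ 2 ≠ 0 := pow_ne_zero 2 (sub_ne_zero.2 hne)
    rcases rat_eq_of_add_inv hk hαk (t := T) (by rw [← hT, hβα]) with rfl | rfl | rfl | rfl | rfl
    · exact absurd (by rw [hsq]; norm_num) hsq0
    · simp
    · simp
    · simp
    · exact absurd (by rw [hsq]; norm_num) hsq0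
  · left
    have hβα : β ^ 2 = (α ^ 2)⁻¹ := eq_inv_of_mul_eq_one_right (by
      rw [← mul_pow, hD]; norm_num)
    -- This sum is at most 2, which leaves only `T = 0`.
    have hsum : α ^ 2 + (α ^ 2)⁻¹ = ((T ^ 2 + 2 : ℚ) : ℂ) := by
      rw [← hβα]
      push_cast at hD ⊢
      linear_combination (α + β + T) * hT - 2 * hD
    have := rat_eq_of_add_inv hk (by rw [← pow_mul, mul_comm, pow_mul, hαk, one_pow]) hsum
    have h0 := sq_nonneg T
    have : T ^ 2 = 0 := by
      rcases this with h | h | h | h | h <;> linarith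
    exact pow_eq_zero_iff two_ne_zero |>.1 this

lemma odd_of_pow_ne_neg_pow {R : Type*} [Ring R] {a : R} {n : ℕ} (h : a ^ n ≠ (-a) ^ n) :
    Odd n := by
  rw [← Nat.not_even_iff_odd]
  exact fun hn => h (hn.neg_pow a).symm

/-- The congruences forced by a solution with eigenvalues the primitive sixth roots of unity. -/
lemma mod_six_of_relations {i j : ℕ} {α β : ℂ} (hs : α + β = 1) (hp : α * β = 1)
    (h1 : α ^ j = -β ^ i) (hne : α ^ i ≠ β ^ i) : (i + j) % 6 = 3 ∧ i % 3 ≠ 0 := by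
  have hq : α ^ 2 = α - 1 := by linear_combination α * hs - hp
  have h3 : α ^ 3 = -1 := by linear_combination (α + 1) * hq
  have h3' : β ^ 3 = -1 := by
    have hβ : β = 1 - α := by linear_combination hs
    rw [hβ]
    linear_combination (2 - α) * hq
  have h6 : α ^ 6 = 1 := by linear_combination (α ^ 3 - 1) * h3
  have hsum : α ^ (i + j) = -1 := by
    rw [pow_add, h1, mul_neg, ← mul_pow, hp, one_pow]
  constructor
  · rw [pow_eq_pow_mod _ h6] at hsum
    have hlt : (i + j) % 6 < 6 := Nat.mod_lt _ (by norm_num)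
    generalize (i + j) % 6 = r at hsum hlt
    have hα1 : α ≠ -1 := by
      rintro rfl
      norm_num at hq
    have hα0 : α ≠ 0 := left_ne_zero_of_mul_eq_one hp
    have hα2 : α ≠ 2 := by
      rintro rfl
      norm_num at hq
    -- `α` is a primitive sixth root of unity, so `α ^ r = -1` only for `r = 3`.
    interval_cases r
    · norm_num at hsum
    · exact absurd (by simpa using hsum) hα1
    · exact absurd (by linear_combination hsum - hq) hα0
    · rfl
    · have : α = 1 := by linear_combination -hsum + α * h3
      rw [this] at hq
      norm_num at hq
    · exact absurd (by linear_combination -hsum + α ^ 2 * h3 - hq) hα2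
  · intro hi
    obtain ⟨k, rfl⟩ := Nat.dvd_of_mod_eq_zero hi
    exact hne (by rw [pow_mul, pow_mul, h3, h3'])

lemma congruences_of_entries {i j : ℕ} (hi : 0 < i) (hj : 0 < j) {x : Matrix (Fin 2) (Fin 2) ℚ}
    (h1 : (x ^ i) 1 0 = 1) (h2 : (x ^ j) 1 0 = 1) (h3 : (x ^ i) 0 0 + (x ^ j) 1 1 = 0) :
    (i = j ∧ ¬ 4 ∣ i) ∨ (Odd i ∧ Odd j) ∨ ((i + j) % 6 = 3 ∧ i % 3 ≠ 0) := by
  set X : Matrix (Fin 2) (Fin 2) ℂ := (algebraMap ℚ ℂ).mapMatrix x with hX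
  have hXpow : ∀ n k l, (X ^ n) k l = ((x ^ n) k l : ℚ) := fun n k l => by
    rw [hX, ← map_pow]
    simp
  have H1 : (X ^ i) 1 0 = 1 := by rw [hXpow, h1, Rat.cast_one]
  have H2 : (X ^ j) 1 0 = 1 := by rw [hXpow, h2, Rat.cast_one]
  have H3 : (X ^ i) 0 0 + (X ^ j) 1 1 = 0 := by
    rw [hXpow, hXpow, ← Rat.cast_add, h3, Rat.cast_zero]
  obtain ⟨α, β, hs, hp⟩ : ∃ α β : ℂ, α + β = X 0 0 + X 1 1 ∧
      α * β = X 0 0 * X 1 1 - X 0 1 * X 1 0 := by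
    obtain ⟨s, hs⟩ := IsAlgClosed.exists_pow_nat_eq
      ((X 0 0 - X 1 1) ^ 2 + 4 * (X 0 1 * X 1 0)) two_pos
    exact ⟨(X 0 0 + X 1 1 + s) / 2, (X 0 0 + X 1 1 - s) / 2, by ring,
      by linear_combination -hs / 4⟩
  by_cases hne : α = β
  · subst hne
    obtain ⟨rfl, rfl⟩ := eq_one_of_double_eigenvalue hi hj hs hp H1 H2 H3
    exact Or.inr (Or.inl ⟨odd_one, odd_one⟩)
  obtain ⟨e1, e2, n1, n2⟩ := eigenvalue_relations hs hp hne H1 H2 H3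
  have hT : α + β = ((x 0 0 + x 1 1 : ℚ) : ℂ) := by
    rw [hs]; simp [hX]
  have hD : α * β = ((x 0 0 * x 1 1 - x 0 1 * x 1 0 : ℚ) : ℂ) := by
    rw [hp]; simp [hX]
  have hα : α ≠ 0 := by
    rintro rfl
    rw [zero_pow hj.ne', eq_comm, neg_eq_zero] at e1
    exact hne (pow_eq_zero_iff hi.ne' |>.1 e1).symm
  have hβ : β ≠ 0 := by
    rintro rfl
    rw [zero_pow hi.ne', neg_zero] at e1
    exact hne (pow_eq_zero_iff hj.ne' |>.1 e1)
  by_cases hij : i = j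
  · subst hij
    exact Or.inl ⟨rfl, not_four_dvd_of_relations hi hT hD hα hβ e1⟩
  right
  rcases trace_det_of_relations hij hT hD hα hβ hne e1 e2 with h | ⟨hd, h | h⟩
  · left
    have hβα : β = -α := by
      rw [h, Rat.cast_zero] at hT
      linear_combination hT
    subst hβα
    exact ⟨odd_of_pow_ne_neg_pow n1, odd_of_pow_ne_neg_pow n2⟩
  · right
    rw [h, Rat.cast_one] at hT
    rw [hd, Rat.cast_one] at hD
    exact mod_six_of_relations hT hD e1 n1
  -- Here `α` is a cube root of unity, but its power `α ^ (i + j) = -1` is not.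
  · exfalso
    rw [h] at hT
    rw [hd, Rat.cast_one] at hD
    push_cast at hT
    have hcube : α ^ 3 = 1 := by linear_combination (α ^ 2 - α) * hT - (α - 1) * hD
    have hsum : α ^ (i + j) = -1 := by
      rw [pow_add, e1, mul_neg, ← mul_pow, hD, one_pow]
    have : (α ^ (i + j)) ^ 3 = 1 := by
      rw [← pow_mul, mul_comm, pow_mul, hcube, one_pow]
    rw [hsum] at this
    norm_num at this

/-! ### Explicit solutions -/

lemma exists_rel_of_odd {i j : ℕ} (hi : Odd i) (hj : Odd j) :
    ∃ x y : Matrix (Fin 2) (Fin 2) ℚ, x ^ i * y + y * x ^ j = 1 ∧ y ^ 2 = 0 := by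
  have hx : (!![0, 1; 1, 0] : Matrix (Fin 2) (Fin 2) ℚ) ^ 2 = 1 := by
    simp [sq, Matrix.one_fin_two]
  have hpow : ∀ n, Odd n → (!![0, 1; 1, 0] : Matrix (Fin 2) (Fin 2) ℚ) ^ n = !![0, 1; 1, 0] := by
    rintro n ⟨k, rfl⟩
    rw [pow_succ, pow_mul, hx, one_pow, one_mul]
  apply exists_rel_of_entries !![0, 1; 1, 0] <;> simp [hpow i hi, hpow j hj]

/-- The matrix used has eigenvalues `1 ± √-1`: its square has zero diagonal and its fourth power is
`-4`. The parameter `s` normalises the lower-left entry of the power to 1. -/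
lemma exists_rel_of_two_mod_four (k : ℕ) :
    ∃ x y : Matrix (Fin 2) (Fin 2) ℚ,
      x ^ (4 * k + 2) * y + y * x ^ (4 * k + 2) = 1 ∧ y ^ 2 = 0 := by
  have hc : ((-4 : ℚ) ^ k) ≠ 0 := pow_ne_zero _ (by norm_num)
  set s : ℚ := (2 * (-4) ^ k)⁻¹ with hs
  have hs0 : s ≠ 0 := by positivity
  set x : Matrix (Fin 2) (Fin 2) ℚ := !![1, -s⁻¹; s, 1] with hx
  have hx2 : x ^ 2 = !![0, -2 * s⁻¹; 2 * s, 0] := by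
    rw [hx, sq]
    ext a b
    fin_cases a <;> fin_cases b <;> simp [hs0] <;> ring
  have hx4 : x ^ 4 = (-4 : ℚ) • 1 := by
    rw [show 4 = 2 * 2 from rfl, pow_mul, hx2, sq]
    ext a b
    fin_cases a <;> fin_cases b <;> simp <;> field_simp <;> norm_num
  have hpow : x ^ (4 * k + 2) = ((-4 : ℚ) ^ k) • !![0, -2 * s⁻¹; 2 * s, 0] := by
    rw [pow_add, pow_mul, hx4, hx2, smul_pow, one_pow, smul_mul_assoc, one_mul]
  have h10 : (-4 : ℚ) ^ k * (2 * s) = 1 := by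
    rw [hs]; field_simp
  apply exists_rel_of_entries x <;> rw [hpow] <;> simp [h10]

/-- Both matrices have trace and determinant 1, hence order 6. They differ by the sign of the
off-diagonal entries, since the lower-left entry of the `n`-th power changes sign between `n ≡ 1, 2`
and `n ≡ 4, 5` mod 6. -/
lemma exists_rel_of_mod_six {i j : ℕ}
    (h : (i % 6 = 1 ∧ j % 6 = 2) ∨ (i % 6 = 2 ∧ j % 6 = 1) ∨ (i % 6 = 4 ∧ j % 6 = 5) ∨
      (i % 6 = 5 ∧ j % 6 = 4)) :
    ∃ x y : Matrix (Fin 2) (Fin 2) ℚ, x ^ i * y + y * x ^ j = 1 ∧ y ^ 2 = 0 := by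
  have h6 : (!![0, -1; 1, 1] : Matrix (Fin 2) (Fin 2) ℚ) ^ 6 = 1 := by
    simp [pow_succ, Matrix.one_fin_two]
  have h6' : (!![0, 1; -1, 1] : Matrix (Fin 2) (Fin 2) ℚ) ^ 6 = 1 := by
    simp [pow_succ, Matrix.one_fin_two]
  rcases h with ⟨h, h'⟩ | ⟨h, h'⟩ | ⟨h, h'⟩ | ⟨h, h'⟩
  · apply exists_rel_of_entries !![0, -1; 1, 1] <;>
      simp [pow_eq_pow_mod i h6, pow_eq_pow_mod j h6, h, h', pow_succ]
  · apply exists_rel_of_entries !![0, -1; 1, 1] <;>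
      simp [pow_eq_pow_mod i h6, pow_eq_pow_mod j h6, h, h', pow_succ]
  · apply exists_rel_of_entries !![0, 1; -1, 1] <;>
      simp [pow_eq_pow_mod i h6', pow_eq_pow_mod j h6', h, h', pow_succ]
  · apply exists_rel_of_entries !![0, 1; -1, 1] <;>
      simp [pow_eq_pow_mod i h6', pow_eq_pow_mod j h6', h, h', pow_succ]

end MatrixRelations

theorem theorem3p7 (i j : ℕ) (hi : 0 < i) (hj : 0 < j) :
    (i, j, 1, 1) ∈ MatrixRelations.setA ℚ ↔
      (i = j ∧ ¬ i ≡ 0 [MOD 4]) ∨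
      (i ≡ 1 [MOD 2] ∧ j ≡ 1 [MOD 2]) ∨
      (i ≡ 1 [MOD 6] ∧ j ≡ 2 [MOD 6]) ∨
      (i ≡ 2 [MOD 6] ∧ j ≡ 1 [MOD 6]) ∨
      (i ≡ 4 [MOD 6] ∧ j ≡ 5 [MOD 6]) ∨
      (i ≡ 5 [MOD 6] ∧ j ≡ 4 [MOD 6]) := by
  rw [MatrixRelations.mem_setA_one_one_iff hi hj]
  simp only [Nat.ModEq, Nat.reduceMod]
  constructor
  · rintro ⟨x, y, h, hy⟩
    obtain ⟨z, h1, h2, h3⟩ := MatrixRelations.exists_entries_of_rel h hy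
    rcases MatrixRelations.congruences_of_entries hi hj h1 h2 h3 with
      ⟨rfl, h⟩ | ⟨h, h'⟩ | ⟨h, h'⟩
    · exact Or.inl ⟨rfl, by omega⟩
    · exact Or.inr (Or.inl ⟨Nat.odd_iff.1 h, Nat.odd_iff.1 h'⟩)
    · have hi6 : i % 6 = 1 ∨ i % 6 = 2 ∨ i % 6 = 4 ∨ i % 6 = 5 := by omega
      right; right
      rcases hi6 with hi6 | hi6 | hi6 | hi6 <;> omega
  · rintro (⟨rfl, h⟩ | ⟨h, h'⟩ | h)
    · rcases Nat.even_or_odd i with he | ho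
      · obtain ⟨k, rfl⟩ : ∃ k, i = 4 * k + 2 := ⟨i / 4, by rw [Nat.even_iff] at he; omega⟩
        exact MatrixRelations.exists_rel_of_two_mod_four k
      · exact MatrixRelations.exists_rel_of_odd ho ho
    · exact MatrixRelations.exists_rel_of_odd (Nat.odd_iff.2 h) (Nat.odd_iff.2 h')
    · exact MatrixRelations.exists_rel_of_mod_six h
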